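/- Let $|m\rangle$, $m=0,1,2,\dots$, be the Fock basis of one bosonic mode (the Hilbert space $\ell^2(\mathbb N)$), with $a^\dagger|m\rangle=\sqrt{m+1}\,|m+1\rangle$ and $a|m\rangle=\sqrt m\,|m-1\rangle$, and let $D(\alpha)=\exp(\alpha a^\dagger-\alpha^* a)$ be the displacement operator. For $\beta\in\mathbb C$ let $A(\beta)$ be the sensing matrix of excitation counting after the displacement $D(-\beta)$, i.e. $$A_{n,(m_1,m_2)}(\beta)=\operatorname{tr}\bigl[\,|n\rangle\langle n|\,D(-\beta)\,|m_1\rangle\langle m_2|\,D(-\beta)^\dagger\bigr],\qquad n,m_1,m_2\in\mathbb N ,$$ and let $C(\beta)=A(\beta)^\dagger A(\beta)$ be its covariance matrix, with entries $$C_{m_1m_2,m_3m_4}(\beta)=\sum_{n=0}^{\infty}A_{n,(m_1,m_2)}(\beta)^*\,A_{n,(m_3,m_4)}(\beta).$$ **Theorem (parity selection rule).** There is a nowhere vanishing complex-valued function $g(m_1,m_2,m_3,m_4,\phi)$ of $m_1,m_2,m_3,m_4\in\mathbb N$ and $\phi\in\mathbb R$ such that, for all $m_1,m_2,m_3,m_4\in\mathbb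 N$, as $|\beta|\to\infty$ in $\mathbb C$, with $\phi=\arg\beta$, $$C_{m_1m_2,m_3m_4}(\beta)\sim\begin{cases} g(m_1,m_2,m_3,m_4,\phi)/|\beta|, & m_1+m_2+m_3+m_4 \text{ even},\\[2pt] g(m_1,m_2,m_3,m_4,\phi)/|\beta|^2, & m_1+m_2+m_3+m_4\text{ odd}.\end{cases}$$ Here $u\sim v$ means $u-v=o(v)$ as $|\beta|\to\infty$ (uniformly in $\arg\beta$). -/

import Mathlib

open scoped Asymptotics

noncomputable section

namespace FockTomography

/-- The state space of one bosonic mode, `ℓ²(ℕ)`; the index is the excitation number. -/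
abbrev FockSpace : Type := lp (fun _ : ℕ => ℂ) 2

/-- The Fock state `|m⟩`, with exactly `m` excitations. -/
def fock (m : ℕ) : FockSpace := lp.single 2 m (1 : ℂ)

/-- The dense subspace of finite linear combinations of Fock states, the common invariant domain
of the ladder operators, is modelled by `ℕ →₀ ℂ`; this is its inclusion into `FockSpace`. -/
def embed : (ℕ →₀ ℂ) →ₗ[ℂ] FockSpace := Finsupp.linearCombination ℂ fock

/-- The creation operator: `a†|m⟩ = √(m+1) |m+1⟩`. -/
def creation : Module.End ℂ (ℕ →₀ ℂ) :=
  Finsupp.linearCombination ℂ fun m => Finsupp.single (m + 1) ((Real.sqrt (m + 1) : ℝ) : ℂ)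

/-- The annihilation operator: `a|m⟩ = √m |m-1⟩`, in particular `a|0⟩ = 0`. -/
def annihilation : Module.End ℂ (ℕ →₀ ℂ) :=
  Finsupp.linearCombination ℂ fun m => Finsupp.single (m - 1) ((Real.sqrt m : ℝ) : ℂ)

/-- The skew-symmetric operator `α a† - α* a`. -/
def generator (α : ℂ) : Module.End ℂ (ℕ →₀ ℂ) :=
  α • creation - (starRingEnd ℂ α) • annihilation

/-- The displacement operator `D(α) = exp(α a† - α* a)` on finite linear combinations of Fock
states. These are entire analytic vectors of the generator, so that the exponential series
converges in norm on each of them. -/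
def displacement (α : ℂ) : (ℕ →₀ ℂ) →ₗ[ℂ] FockSpace :=
  Finsupp.linearCombination ℂ fun m =>
    ∑' k : ℕ, ((k.factorial : ℂ))⁻¹ • embed ((generator α ^ k) (Finsupp.single m 1))

/-- The displaced Fock state `D(α)|m⟩`. -/
def displacedFock (α : ℂ) (m : ℕ) : FockSpace := displacement α (Finsupp.single m 1)

/-- The operator `|u⟩⟨v|`. -/
def ketBra (u v : FockSpace) : FockSpace →L[ℂ] FockSpace := InnerProductSpace.rankOne ℂ u v

/-- The trace `∑ₖ ⟨k|T|k⟩` of a (trace class) operator. -/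
def trace (T : FockSpace →L[ℂ] FockSpace) : ℂ := ∑' k : ℕ, inner ℂ (fock k) (T (fock k))

/-- The sensing matrix of excitation counting after the displacement `D(-β)`. Rows are indexed by
the number `n` of counted excitations, columns by the pairs `(m₁, m₂)`, for `|m₁⟩⟨m₂|`:
`A_{n,(m₁,m₂)} = tr[ |n⟩⟨n| D(-β) |m₁⟩⟨m₂| D(-β)† ]`. -/
def sensingMatrix (β : ℂ) : Matrix ℕ (ℕ × ℕ) ℂ := fun n p =>
  trace (ketBra (fock n) (fock n) ∘L ketBra (displacedFock (-β) p.1) (displacedFock (-β) p.2))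

/-- The covariance matrix `C(β) = A(β)† A(β)`; the sum runs over all excitation numbers `n`. -/
def covarianceMatrix (β : ℂ) : Matrix (ℕ × ℕ) (ℕ × ℕ) ℂ := fun p q =>
  ∑' n : ℕ, starRingEnd ℂ (sensingMatrix β n p) * sensingMatrix β n q

end FockTomography

end

/-! By Parseval, an entry of the covariance matrix is an integral over `w = exp(iθ)` of two
generating series `∑ₙ ⟨n|D|m₁⟩ ⟨n|D|m₂⟩* wⁿ = ⟨m₂|D† w^N D|m₁⟩`, where `N` is the number operator.
The relations between `D` and the ladder operators give recursions in `m₁`, `m₂` that determine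
these series: each is `exp(|β|²(w - 1))` times a phase and a polynomial in `y = 2|β| sin(θ/2)` that
is, up to normalisation, monic over `ℤ`, of degree `m₁ + m₂` and of the parity of its degree. Hence,
up to a nonzero factor that depends only on `arg β`, the entry is `∫ exp(-y²) P(y) exp(iDθ/2) dθ`
with `P` monic of degree `m₁ + m₂ + m₃ + m₄` and `D = m₃ + m₄ - m₁ - m₂`.

As `|β| → ∞` the weight concentrates at `θ ≈ y/|β|`. If `P` is even, the leading term is
`|β|⁻¹ ∫ exp(-y²) P(y) dy`. If `P` is odd, this integral vanishes, and the next term of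
`exp(iDθ/2)` gives `|β|⁻² (iD/2) ∫ exp(-y²) y P(y) dy`, where `D ≠ 0` by parity. Neither Gaussian
integral is zero: for a monic integer polynomial of degree `2M`, `2^M/√π` times the integral is a
sum of even integers and the odd integer `(2M - 1)‼`. -/

namespace FockTomography

open Filter Finsupp MeasureTheory Polynomial Topology
open Complex (I)
open scoped ComplexConjugate Nat Real

/-! ### Ladder operators -/

lemma ofReal_sqrt_mul_self {x : ℝ} (hx : 0 ≤ x) : (√x : ℂ) * √x = x := by
  exact_mod_cast Real.mul_self_sqrt hx

lemma creation_single (m : ℕ) (c : ℂ) : creation (single m c) = single (m + 1) (c * √(m + 1)) := by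
  simp [creation]

lemma annihilation_single (m : ℕ) (c : ℂ) :
    annihilation (single m c) = single (m - 1) (c * √m) := by
  simp [annihilation]

lemma creation_apply (u : ℕ →₀ ℂ) (n : ℕ) : creation u n = √n * u (n - 1) := by
  induction u using Finsupp.induction_linear with
  | zero => simp
  | add u v hu hv => simp [hu, hv, mul_add]
  | single m c =>
    rcases n with _ | n
    · simp [creation_single]
    · rcases eq_or_ne m n with rfl | h
      · simp [creation_single, mul_comm]
      · simp [creation_single, h]

lemma annihilation_apply (u : ℕ →₀ ℂ) (n : ℕ) : annihilation u n = √(n + 1) * u (n + 1) := by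
  induction u using Finsupp.induction_linear with
  | zero => simp
  | add u v hu hv => simp [hu, hv, mul_add]
  | single m c =>
    rcases m with _ | m
    · simp [annihilation_single]
    · rcases eq_or_ne m n with rfl | h
      · simp [annihilation_single, mul_comm]
      · simp [annihilation_single, h]

lemma creation_mul_annihilation :
    creation * annihilation = annihilation * creation - (1 : ℂ) • 1 := by
  refine LinearMap.ext fun u => Finsupp.ext fun n => ?_
  have hsucc := ofReal_sqrt_mul_self (x := n + 1) (by positivity)
  simp only [Module.End.mul_apply, LinearMap.sub_apply, one_smul, Module.End.one_apply,
    Finsupp.sub_apply, annihilation_apply, creation_apply, Nat.add_sub_cancel, ← mul_assoc]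
  push_cast at hsucc ⊢
  rcases n with _ | n
  · simp
  · have hself := ofReal_sqrt_mul_self (x := n + 1) (by positivity)
    simp only [Nat.add_sub_cancel]
    push_cast at hself hsucc ⊢
    linear_combination u (n + 1) * hself - u (n + 1) * hsucc

lemma generator_mul_creation (α : ℂ) :
    generator α * creation = creation * generator α - conj α • 1 := by
  refine LinearMap.ext fun u => ?_
  have h := LinearMap.congr_fun creation_mul_annihilation u
  simp only [generator, Module.End.mul_apply, LinearMap.sub_apply, LinearMap.smul_apply,
    Module.End.one_apply, map_sub, map_smul] at h ⊢
  rw [h]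
  module

lemma generator_mul_annihilation (α : ℂ) :
    generator α * annihilation = annihilation * generator α - α • 1 := by
  refine LinearMap.ext fun u => ?_
  have h := LinearMap.congr_fun creation_mul_annihilation u
  simp only [generator, Module.End.mul_apply, LinearMap.sub_apply, LinearMap.smul_apply,
    Module.End.one_apply, map_sub, map_smul] at h ⊢
  rw [h]
  module

lemma pow_succ_mul_eq_mul_pow_succ_sub {R A : Type*} [CommRing R] [Ring A] [Algebra R A] {x y : A}
    {c : R} (h : x * y = y * x - c • 1) (k : ℕ) :
    x ^ (k + 1) * y = y * x ^ (k + 1) - ((k + 1) * c) • x ^ k := by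
  induction k with
  | zero => simpa using h
  | succ k ih =>
    calc x ^ (k + 1 + 1) * y = x * (x ^ (k + 1) * y) := by rw [pow_succ', mul_assoc]
      _ = (x * y) * x ^ (k + 1) - ((k + 1) * c) • x ^ (k + 1) := by
        rw [ih, mul_sub, mul_smul_comm, ← pow_succ', mul_assoc]
      _ = y * x ^ (k + 1 + 1) - c • x ^ (k + 1) - ((k + 1) * c) • x ^ (k + 1) := by
        rw [h, sub_mul, smul_mul_assoc, one_mul, mul_assoc, ← pow_succ']
      _ = y * x ^ (k + 1 + 1) - (((k + 1 : ℕ) + 1) * c) • x ^ (k + 1) := by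
        push_cast
        module

lemma creation_pow_vacuum (m : ℕ) : (creation ^ m) (single 0 1) = single m (√(m !) : ℂ) := by
  induction m with
  | zero => simp
  | succ m ih =>
    rw [pow_succ', Module.End.mul_apply, ih, creation_single, Nat.factorial_succ, mul_comm (m + 1)]
    push_cast
    rw [Real.sqrt_mul (by positivity), Complex.ofReal_mul]

lemma annihilation_creation_pow_vacuum (m : ℕ) :
    annihilation ((creation ^ m) (single 0 1)) = (m : ℂ) • (creation ^ (m - 1)) (single 0 1) := by
  rcases m with _ | m
  · simp [annihilation_single]
  · have hcomm := pow_succ_mul_eq_mul_pow_succ_sub (A := Module.End ℂ (ℕ →₀ ℂ))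
      creation_mul_annihilation m
    have h := LinearMap.congr_fun hcomm (single 0 1)
    simp only [Module.End.mul_apply, LinearMap.sub_apply, LinearMap.smul_apply,
      annihilation_single, Nat.cast_zero, Real.sqrt_zero, Complex.ofReal_zero, mul_zero,
      single_zero, map_zero, mul_one] at h
    rw [sub_eq_zero.mp h.symm]
    push_cast
    rfl

/-! ### The exponential series of the displacement operator -/

lemma embed_apply (u : ℕ →₀ ℂ) (n : ℕ) : embed u n = u n := by
  induction u using Finsupp.induction_linear with
  | zero => simp
  | add u v hu hv => simp [hu, hv]
  | single m c =>
    rcases eq_or_ne m n with rfl | h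
    · simp [embed, fock]
    · simp [embed, fock, h]

lemma generator_single (α : ℂ) (m : ℕ) :
    generator α (single m 1)
      = (α * √(m + 1)) • single (m + 1) 1 - (conj α * √m) • single (m - 1) 1 := by
  simp [generator, creation_single, annihilation_single]

lemma sqrt_mul_sqrt_ascFactorial (m k : ℕ) :
    √(m + 1) * √((m + 1 + 1).ascFactorial k) = √((m + 1).ascFactorial (k + 1)) := by
  rw [← Real.sqrt_mul (by positivity), Nat.ascFactorial_succ, ← Nat.succ_ascFactorial]
  push_cast
  rfl

lemma norm_embed_generator_pow_le (α : ℂ) (k m : ℕ) :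
    ‖embed ((generator α ^ k) (single m 1))‖ ≤ (2 * ‖α‖) ^ k * √((m + 1).ascFactorial k) := by
  induction k generalizing m with
  | zero => simp [embed, fock]
  | succ k ih =>
    have hlower : √m * √((m - 1 + 1).ascFactorial k) ≤ √((m + 1).ascFactorial (k + 1)) := by
      rw [← sqrt_mul_sqrt_ascFactorial]
      have hasc : (m - 1 + 1).ascFactorial k ≤ (m + 1 + 1).ascFactorial k :=
        Nat.ascFactorial_le k (by lia)
      gcongr
      linarith
    rw [pow_succ, Module.End.mul_apply, generator_single, map_sub, map_sub, map_smul, map_smul,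
      map_smul, map_smul]
    calc _ ≤ ‖α‖ * √(m + 1) * ‖embed ((generator α ^ k) (single (m + 1) 1))‖
          + ‖α‖ * √m * ‖embed ((generator α ^ k) (single (m - 1) 1))‖ := by
          refine (norm_sub_le _ _).trans_eq ?_
          simp only [norm_smul, norm_mul, RCLike.norm_conj, Complex.norm_real,
            Real.norm_of_nonneg (Real.sqrt_nonneg _)]
      _ ≤ ‖α‖ * √(m + 1) * ((2 * ‖α‖) ^ k * √((m + 1 + 1).ascFactorial k))
          + ‖α‖ * √m * ((2 * ‖α‖) ^ k * √((m - 1 + 1).ascFactorial k)) := by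
          gcongr <;> exact ih _
      _ = ‖α‖ * (2 * ‖α‖) ^ k * (√(m + 1) * √((m + 1 + 1).ascFactorial k))
          + ‖α‖ * (2 * ‖α‖) ^ k * (√m * √((m - 1 + 1).ascFactorial k)) := by ring
      _ ≤ ‖α‖ * (2 * ‖α‖) ^ k * √((m + 1).ascFactorial (k + 1))
          + ‖α‖ * (2 * ‖α‖) ^ k * √((m + 1).ascFactorial (k + 1)) := by
          rw [sqrt_mul_sqrt_ascFactorial]
          gcongr
      _ = (2 * ‖α‖) ^ (k + 1) * √((m + 1).ascFactorial (k + 1)) := by ring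

lemma summable_pow_mul_sqrt_ascFactorial_div_factorial {c : ℝ} (hc : 0 ≤ c) (m : ℕ) :
    Summable fun k : ℕ => (k ! : ℝ)⁻¹ * (c ^ k * √((m + 1).ascFactorial k)) := by
  have hchoose : Summable fun k : ℕ => ((k + m).choose m : ℝ) * (1 / 2) ^ k :=
    summable_choose_mul_geometric_of_norm_lt_one m (by norm_num)
  refine (hchoose.add (Real.summable_pow_div_factorial (2 * c ^ 2))).of_nonneg_of_le
    (fun k => by positivity) fun k => ?_
  have hasc : ((m + 1).ascFactorial k : ℝ) = k ! * (k + m).choose m := by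
    rw [Nat.ascFactorial_eq_factorial_mul_choose, Nat.cast_mul, Nat.add_comm m k,
      Nat.choose_symm_add]
  have hpow : (c ^ k) ^ 2 = (1 / 2) ^ k * (2 * c ^ 2) ^ k := by
    rw [← mul_pow, ← pow_mul, mul_comm k 2, pow_mul]
    congr 1
    ring
  -- AM-GM for the square root of the product of the two majorants
  have hamgm (x y : ℝ) (hx : 0 ≤ x) (hy : 0 ≤ y) : √(x * y) ≤ x + y :=
    Real.sqrt_le_iff.mpr ⟨by positivity, by nlinarith⟩
  refine le_trans (le_of_eq ?_) (hamgm _ _ (by positivity) (by positivity))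
  rw [eq_comm, Real.sqrt_eq_iff_mul_self_eq (by positivity) (by positivity)]
  have hsqrt := Real.sq_sqrt (Nat.cast_nonneg (α := ℝ) ((m + 1).ascFactorial k))
  have hsq : ((k ! : ℝ)⁻¹ * (c ^ k * √((m + 1).ascFactorial k))) ^ 2
      = (k ! : ℝ)⁻¹ ^ 2 * ((c ^ k) ^ 2 * √((m + 1).ascFactorial k) ^ 2) := by ring
  rw [← sq, hsq, hsqrt, hpow, hasc]
  field_simp

lemma hasSum_displacement (α : ℂ) (u : ℕ →₀ ℂ) :
    HasSum (fun k : ℕ => (k ! : ℂ)⁻¹ • embed ((generator α ^ k) u)) (displacement α u) := by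
  induction u using Finsupp.induction_linear with
  | zero => simp [hasSum_zero]
  | add u v hu hv => simpa only [map_add, smul_add] using hu.add hv
  | single m c =>
    have hm : Summable fun k : ℕ => (k ! : ℂ)⁻¹ • embed ((generator α ^ k) (single m 1)) := by
      refine (summable_pow_mul_sqrt_ascFactorial_div_factorial (c := 2 * ‖α‖) (by positivity)
        m).of_norm_bounded fun k => ?_
      rw [norm_smul, norm_inv, Complex.norm_natCast]
      gcongr
      exact norm_embed_generator_pow_le α k m
    have h := hm.hasSum.const_smul c
    rw [← smul_single_one m c]
    simpa only [map_smul, smul_comm c, displacement, linearCombination_single, one_smul] using h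

lemma hasSum_displacement_apply (α : ℂ) (u : ℕ →₀ ℂ) (n : ℕ) :
    HasSum (fun k : ℕ => (k ! : ℂ)⁻¹ * (generator α ^ k) u n) (displacement α u n) := by
  simp_rw [← embed_apply]
  exact (lp.evalCLM ℂ (fun _ : ℕ => ℂ) 2 n).hasSum (hasSum_displacement α u)

-- Termwise, `T Gᵏ = Gᵏ T + k c Gᵏ⁻¹` for `G = generator α`, that is, `T D(α) = D(α) (T + c)`.
lemma hasSum_displacement_of_commutator {α c : ℂ} {T : Module.End ℂ (ℕ →₀ ℂ)}
    (hT : generator α * T = T * generator α - c • 1) (u : ℕ →₀ ℂ) (n : ℕ) :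
    HasSum (fun k : ℕ => (k ! : ℂ)⁻¹ * T ((generator α ^ k) u) n)
      (displacement α (T u) n + c * displacement α u n) := by
  have htail := ((hasSum_nat_add_iff' 1).mpr (hasSum_displacement_apply α (T u) n)).add
    ((hasSum_displacement_apply α u n).mul_left c)
  refine (hasSum_nat_add_iff' 1).mp ?_
  convert htail using 1
  · funext k
    have hcomm := pow_succ_mul_eq_mul_pow_succ_sub (A := Module.End ℂ (ℕ →₀ ℂ)) hT k
    have h := DFunLike.congr_fun (LinearMap.congr_fun hcomm u) n
    simp only [Module.End.mul_apply, LinearMap.sub_apply, LinearMap.smul_apply, Finsupp.sub_apply,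
      Finsupp.smul_apply, smul_eq_mul] at h
    rw [h, Nat.factorial_succ]
    push_cast
    field_simp
    ring
  · simp only [Finset.range_one, Finset.sum_singleton, Nat.factorial_zero, Nat.cast_one, inv_one,
      pow_zero, Module.End.one_apply, one_mul]
    ring

lemma displacement_creation_apply (α : ℂ) (u : ℕ →₀ ℂ) (n : ℕ) :
    displacement α (creation u) n
      = √n * displacement α u (n - 1) - conj α * displacement α u n := by
  refine eq_sub_of_add_eq
    ((hasSum_displacement_of_commutator (generator_mul_creation α) u n).unique ?_)
  simpa only [creation_apply, mul_left_comm] using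
    (hasSum_displacement_apply α u (n - 1)).mul_left (√n : ℂ)

lemma displacement_annihilation_apply (α : ℂ) (u : ℕ →₀ ℂ) (n : ℕ) :
    displacement α (annihilation u) n
      = √(n + 1) * displacement α u (n + 1) - α * displacement α u n := by
  refine eq_sub_of_add_eq
    ((hasSum_displacement_of_commutator (generator_mul_annihilation α) u n).unique ?_)
  simpa only [annihilation_apply, mul_left_comm] using
    (hasSum_displacement_apply α u (n + 1)).mul_left (√(n + 1) : ℂ)

/-! ### Displaced Fock states -/

/-- The coefficient `√m! ⟨n|D(α)|m⟩` of the displacement operator between `|n⟩` and the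
unnormalised state `(a†)ᵐ|0⟩ = √m! |m⟩`; with this normalisation the recursions in `m` involve no
square roots of `m`. -/
noncomputable def displacedCoeff (α : ℂ) (n m : ℕ) : ℂ :=
  displacement α ((creation ^ m) (single 0 1)) n

lemma displacedCoeff_eq_sqrt_factorial_mul (α : ℂ) (n m : ℕ) :
    displacedCoeff α n m = √(m !) * displacedFock α m n := by
  rw [displacedCoeff, creation_pow_vacuum, ← smul_single_one, map_smul]
  rfl

lemma displacedCoeff_succ_right (α : ℂ) (n m : ℕ) :
    displacedCoeff α n (m + 1)
      = √n * displacedCoeff α (n - 1) m - conj α * displacedCoeff α n m := by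
  simp only [displacedCoeff, pow_succ', Module.End.mul_apply, displacement_creation_apply]

lemma sqrt_mul_displacedCoeff_succ_left (α : ℂ) (n m : ℕ) :
    √(n + 1) * displacedCoeff α (n + 1) m
      = m * displacedCoeff α n (m - 1) + α * displacedCoeff α n m := by
  have h := displacement_annihilation_apply α ((creation ^ m) (single 0 1)) n
  rw [annihilation_creation_pow_vacuum, map_smul] at h
  exact (eq_sub_iff_add_eq.mp h).symm

lemma generator_pow_add_two_vacuum_apply_zero (α : ℂ) (k : ℕ) :
    (generator α ^ (k + 2)) (single 0 1) 0
      = (k + 1) * -(‖α‖ : ℂ) ^ 2 * (generator α ^ k) (single 0 1) 0 := by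
  have hvac : generator α (single 0 1) = α • creation (single 0 1) := by
    simp [generator, annihilation_single]
  have hcomm := pow_succ_mul_eq_mul_pow_succ_sub (A := Module.End ℂ (ℕ →₀ ℂ))
    (generator_mul_creation α) k
  have h := DFunLike.congr_fun (LinearMap.congr_fun hcomm (single 0 1)) 0
  simp only [Module.End.mul_apply, LinearMap.sub_apply, LinearMap.smul_apply, Finsupp.sub_apply,
    Finsupp.smul_apply, smul_eq_mul, creation_apply, Nat.cast_zero, Real.sqrt_zero,
    Complex.ofReal_zero, zero_mul, zero_sub] at h
  rw [pow_succ, Module.End.mul_apply, hvac, map_smul, Finsupp.smul_apply, smul_eq_mul, h,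
    ← Complex.mul_conj']
  ring

lemma factorial_mul_two_pow_mul_generator_pow_vacuum (α : ℂ) (l : ℕ) :
    (l ! : ℂ) * 2 ^ l * (generator α ^ (2 * l)) (single 0 1) 0
      = (2 * l)! * (-(‖α‖ : ℂ) ^ 2) ^ l := by
  induction l with
  | zero => simp
  | succ l ih =>
    rw [mul_add_one, generator_pow_add_two_vacuum_apply_zero, Nat.factorial_succ l,
      Nat.factorial_succ (2 * l + 1), Nat.factorial_succ (2 * l)]
    push_cast
    linear_combination (-(‖α‖ : ℂ) ^ 2) * (2 * (l + 1)) * (2 * l + 1) * ih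

lemma generator_pow_odd_vacuum_apply_zero (α : ℂ) (l : ℕ) :
    (generator α ^ (2 * l + 1)) (single 0 1) 0 = 0 := by
  induction l with
  | zero => simp [generator, creation_single, annihilation_single]
  | succ l ih => rw [mul_add_one, add_right_comm, generator_pow_add_two_vacuum_apply_zero, ih,
      mul_zero]

lemma displacedCoeff_zero_zero (α : ℂ) :
    displacedCoeff α 0 0 = Complex.exp (-(‖α‖ : ℂ) ^ 2 / 2) := by
  have heven : HasSum (fun l : ℕ => ((2 * l)! : ℂ)⁻¹ * (generator α ^ (2 * l)) (single 0 1) 0)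
      (Complex.exp (-(‖α‖ : ℂ) ^ 2 / 2)) := by
    have hterm (l : ℕ) : ((2 * l)! : ℂ)⁻¹ * (generator α ^ (2 * l)) (single 0 1) 0
        = (-(‖α‖ : ℂ) ^ 2 / 2) ^ l / l ! := by
      have hfac := Nat.factorial_ne_zero
      rw [div_pow, inv_mul_eq_div, div_div, div_eq_div_iff (by simp [hfac]) (by simp [hfac])]
      linear_combination factorial_mul_two_pow_mul_generator_pow_vacuum α l
    simp only [hterm, Complex.exp_eq_exp_ℂ]
    exact NormedSpace.expSeries_div_hasSum_exp (-(‖α‖ : ℂ) ^ 2 / 2)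
  have hodd : HasSum (fun l : ℕ => ((2 * l + 1)! : ℂ)⁻¹ *
      (generator α ^ (2 * l + 1)) (single 0 1) 0) 0 := by
    simp only [generator_pow_odd_vacuum_apply_zero, mul_zero, hasSum_zero]
  have h := heven.even_add_odd (f := fun k => (k ! : ℂ)⁻¹ * (generator α ^ k) (single 0 1) 0) hodd
  rw [add_zero] at h
  exact (hasSum_displacement_apply α (single 0 1) 0).unique h

lemma sqrt_factorial_mul_displacedCoeff_zero_right (α : ℂ) (n : ℕ) :
    √(n !) * displacedCoeff α n 0 = α ^ n * Complex.exp (-(‖α‖ : ℂ) ^ 2 / 2) := by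
  induction n with
  | zero => simp [displacedCoeff_zero_zero]
  | succ n ih =>
    have h := sqrt_mul_displacedCoeff_succ_left α n 0
    rw [Nat.factorial_succ, mul_comm (n + 1)]
    push_cast at h ⊢
    rw [Real.sqrt_mul (by positivity), Complex.ofReal_mul]
    linear_combination √(n !) * h + α * ih

lemma displacedCoeff_zero_right_mul_conj (α : ℂ) (n : ℕ) :
    displacedCoeff α n 0 * conj (displacedCoeff α n 0)
      = Complex.exp (-(‖α‖ : ℂ) ^ 2) * (((‖α‖ : ℂ) ^ 2) ^ n / n !) := by
  have hnorm := congrArg (fun z : ℂ => (‖z‖ : ℂ) ^ 2)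
    (sqrt_factorial_mul_displacedCoeff_zero_right α n)
  have hexp : (‖Complex.exp (-(‖α‖ : ℂ) ^ 2 / 2)‖ : ℂ) ^ 2 = Complex.exp (-(‖α‖ : ℂ) ^ 2) := by
    rw [← Complex.mul_conj', ← Complex.exp_conj, ← Complex.exp_add]
    congr 1
    simp [Complex.conj_ofNat]
  have hsqrt : (‖(√(n !) : ℂ)‖ : ℂ) ^ 2 = n ! := by
    rw [← Complex.mul_conj', Complex.conj_ofReal, ofReal_sqrt_mul_self (by positivity),
      Complex.ofReal_natCast]
  simp only [norm_mul, norm_pow, Complex.ofReal_mul, Complex.ofReal_pow, mul_pow, hexp,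
    hsqrt] at hnorm
  rw [Complex.mul_conj', mul_div_assoc', eq_div_iff (by exact_mod_cast n.factorial_ne_zero)]
  linear_combination hnorm

/-! ### The sensing matrix -/

lemma inner_fock_left (n : ℕ) (v : FockSpace) : inner ℂ (fock n) v = v n := by
  simp [fock, lp.inner_single_left]

lemma inner_fock_right (n : ℕ) (v : FockSpace) : inner ℂ v (fock n) = conj (v n) := by
  rw [← inner_conj_symm, inner_fock_left]

lemma sensingMatrix_apply (β : ℂ) (n a b : ℕ) :
    sensingMatrix β n (a, b) = displacedFock (-β) a n * conj (displacedFock (-β) b n) := by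
  rw [sensingMatrix, trace, tsum_eq_single n]
  · simp only [ketBra, ContinuousLinearMap.comp_apply, InnerProductSpace.rankOne_apply,
      inner_smul_right, inner_fock_left, inner_fock_right]
    simp [fock, mul_comm]
  · intro k hk
    simp only [ketBra, ContinuousLinearMap.comp_apply, InnerProductSpace.rankOne_apply,
      inner_smul_right, inner_fock_left]
    simp [fock, hk]

lemma sqrt_factorial_mul_sensingMatrix (β : ℂ) (n a b : ℕ) :
    √(a !) * √(b !) * sensingMatrix β n (a, b)
      = displacedCoeff (-β) n a * conj (displacedCoeff (-β) n b) := by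
  simp only [sensingMatrix_apply, displacedCoeff_eq_sqrt_factorial_mul, map_mul,
    Complex.conj_ofReal]
  ring

/-! ### Overlap series -/

lemma summable_displacedCoeff_mul_conj (α : ℂ) (a b : ℕ) :
    Summable fun n => displacedCoeff α n a * conj (displacedCoeff α n b) := by
  have h := lp.summable_inner (𝕜 := ℂ) (displacement α ((creation ^ b) (single 0 1)))
    (displacement α ((creation ^ a) (single 0 1)))
  simp only [RCLike.inner_apply] at h
  exact h

/-- The series `√a! √b! ∑ₙ ⟨n|D(α)|a⟩ ⟨n|D(α)|b⟩* wⁿ`. For `w = exp(iθ)` it is the Fourier series in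
`θ` whose coefficients are, up to the factor `√a! √b!`, the entries of column `(a, b)` of the
sensing matrix. -/
noncomputable def overlapSeries (α w : ℂ) (a b : ℕ) : ℂ :=
  ∑' n, displacedCoeff α n a * conj (displacedCoeff α n b) * w ^ n

lemma hasSum_overlapSeries (α : ℂ) {w : ℂ} (hw : ‖w‖ = 1) (a b : ℕ) :
    HasSum (fun n => displacedCoeff α n a * conj (displacedCoeff α n b) * w ^ n)
      (overlapSeries α w a b) := by
  refine (Summable.of_norm ?_).hasSum
  simpa only [norm_mul, norm_pow, hw, one_pow, mul_one] using
    (summable_displacedCoeff_mul_conj α a b).norm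

lemma conj_overlapSeries (α w : ℂ) (a b : ℕ) :
    conj (overlapSeries α (conj w) a b) = overlapSeries α w b a := by
  simp only [overlapSeries, Complex.conj_tsum, map_mul, map_pow, Complex.conj_conj]
  exact tsum_congr fun n => by ring

lemma overlapSeries_succ_left (α : ℂ) {w : ℂ} (hw : ‖w‖ = 1) (a b : ℕ) :
    overlapSeries α w (a + 1) b
      = w * b * overlapSeries α w a (b - 1) + conj α * (w - 1) * overlapSeries α w a b := by
  have hab := hasSum_overlapSeries α hw a b
  have hshift : HasSum
      (fun n : ℕ => √n * displacedCoeff α (n - 1) a * conj (displacedCoeff α n b) * w ^ n)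
      (w * b * overlapSeries α w a (b - 1) + w * conj α * overlapSeries α w a b) := by
    have hterm (n : ℕ) : √(n + 1 : ℕ) * displacedCoeff α (n + 1 - 1) a
          * conj (displacedCoeff α (n + 1) b) * w ^ (n + 1)
        = w * b * (displacedCoeff α n a * conj (displacedCoeff α n (b - 1)) * w ^ n)
          + w * conj α * (displacedCoeff α n a * conj (displacedCoeff α n b) * w ^ n) := by
      have h := congrArg conj (sqrt_mul_displacedCoeff_succ_left α n b)
      simp only [map_mul, map_add, map_natCast, Complex.conj_ofReal] at h
      rw [Nat.add_sub_cancel]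
      push_cast
      linear_combination displacedCoeff α n a * w ^ (n + 1) * h
    refine (hasSum_nat_add_iff' 1).mp ?_
    simp only [hterm, Finset.sum_range_one, Nat.cast_zero, Real.sqrt_zero, Complex.ofReal_zero,
      zero_mul, sub_zero]
    exact ((hasSum_overlapSeries α hw a (b - 1)).mul_left _).add (hab.mul_left _)
  have hterm (n : ℕ) : displacedCoeff α n (a + 1) * conj (displacedCoeff α n b) * w ^ n
      = √n * displacedCoeff α (n - 1) a * conj (displacedCoeff α n b) * w ^ n
        - conj α * (displacedCoeff α n a * conj (displacedCoeff α n b) * w ^ n) := by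
    rw [displacedCoeff_succ_right]
    ring
  have h := hasSum_overlapSeries α hw (a + 1) b
  simp only [hterm] at h
  rw [h.unique (hshift.sub (hab.mul_left (conj α)))]
  ring

lemma overlapSeries_zero_succ (α : ℂ) {w : ℂ} (hw : ‖w‖ = 1) (b : ℕ) :
    overlapSeries α w 0 (b + 1) = α * (w - 1) * overlapSeries α w 0 b := by
  have h := congrArg conj (overlapSeries_succ_left α (w := conj w) (by rwa [RCLike.norm_conj]) b 0)
  simpa [conj_overlapSeries] using h

lemma overlapSeries_zero_zero (α : ℂ) {w : ℂ} (hw : ‖w‖ = 1) :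
    overlapSeries α w 0 0 = Complex.exp ((‖α‖ : ℂ) ^ 2 * (w - 1)) := by
  have hterm (n : ℕ) : displacedCoeff α n 0 * conj (displacedCoeff α n 0) * w ^ n
      = Complex.exp (-(‖α‖ : ℂ) ^ 2) * (((‖α‖ : ℂ) ^ 2 * w) ^ n / n !) := by
    rw [displacedCoeff_zero_right_mul_conj, mul_pow]
    ring
  have hexp : HasSum (fun n : ℕ => ((‖α‖ : ℂ) ^ 2 * w) ^ n / n !)
      (Complex.exp ((‖α‖ : ℂ) ^ 2 * w)) := by
    rw [Complex.exp_eq_exp_ℂ]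
    exact NormedSpace.expSeries_div_hasSum_exp _
  have h := hasSum_overlapSeries α hw 0 0
  simp only [hterm] at h
  rw [h.unique (hexp.mul_left _), ← Complex.exp_add]
  congr 1
  ring

/-- Itô's complex Hermite polynomials, restricted to the diagonal `z = z̄` and expressed through the
common value of the two variables. They give the polynomial factor in the closed form of
`overlapSeries`. -/
noncomputable def itoHermite : ℕ → ℕ → ℤ[X]
  | 0, b => X ^ b
  | a + 1, b => X * itoHermite a b - (b : ℤ[X]) * itoHermite a (b - 1)

lemma itoHermite_zero (b : ℕ) : itoHermite 0 b = X ^ b := rfl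

lemma itoHermite_succ (a b : ℕ) :
    itoHermite (a + 1) b = X * itoHermite a b - (b : ℤ[X]) * itoHermite a (b - 1) := rfl

lemma isMonicOfDegree_itoHermite (a b : ℕ) : (itoHermite a b).IsMonicOfDegree (a + b) := by
  induction a generalizing b with
  | zero =>
    rw [zero_add]
    exact isMonicOfDegree_X_pow ℤ b
  | succ a ih =>
    rw [itoHermite_succ, add_right_comm, add_comm (a + b)]
    refine ((isMonicOfDegree_X ℤ).mul (ih b)).sub (natDegree_mul_le.trans_lt ?_)
    rw [natDegree_natCast, (ih (b - 1)).natDegree_eq]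
    lia

lemma aeval_neg_itoHermite {R : Type*} [CommRing R] (y : R) (a b : ℕ) :
    aeval (-y) (itoHermite a b) = (-1) ^ (a + b) * aeval y (itoHermite a b) := by
  induction a generalizing b with
  | zero => simp [itoHermite_zero, neg_pow y]
  | succ a ih =>
    simp only [itoHermite_succ, map_sub, map_mul, aeval_X, ih, map_natCast]
    rcases b with _ | b
    · simp only [Nat.cast_zero]
      ring
    · simp only [Nat.add_sub_cancel]
      ring

lemma overlapSeries_eq_exp_mul_aeval_itoHermite (α : ℂ) {w η η' y : ℂ} (hw : ‖w‖ = 1)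
    (hη : conj α * (w - 1) = η * y) (hη' : α * (w - 1) = η' * y) (hηη' : η * η' = -w) (a b : ℕ) :
    overlapSeries α w a b = Complex.exp ((‖α‖ : ℂ) ^ 2 * (w - 1)) * η ^ a * η' ^ b
      * aeval y (itoHermite a b) := by
  induction a generalizing b with
  | zero =>
    simp only [itoHermite_zero, map_pow, aeval_X, pow_zero, mul_one]
    induction b with
    | zero => simp [overlapSeries_zero_zero α hw]
    | succ b ih =>
      rw [overlapSeries_zero_succ α hw, hη', ih]
      ring
  | succ a ih =>
    rw [overlapSeries_succ_left α hw, hη, ih, ih, itoHermite_succ]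
    simp only [map_sub, map_mul, aeval_X, map_natCast]
    rcases b with _ | b
    · simp only [Nat.cast_zero]
      ring
    · rw [Nat.add_sub_cancel, ← neg_eq_iff_eq_neg.mpr hηη']
      ring

/-! ### Parseval's identity on the circle -/

lemma integral_conj_exp_pow_mul_exp_pow (k n : ℕ) :
    ∫ θ in -π..π, conj (Complex.exp (θ * I) ^ k) * Complex.exp (θ * I) ^ n
      = if k = n then (2 * π : ℂ) else 0 := by
  have hexp (θ : ℝ) : conj (Complex.exp (θ * I) ^ k) * Complex.exp (θ * I) ^ n
      = Complex.exp (((n : ℂ) - k) * I * θ) := by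
    rw [← Complex.exp_nat_mul, ← Complex.exp_nat_mul, ← Complex.exp_conj, ← Complex.exp_add]
    congr 1
    simp only [map_mul, map_natCast, Complex.conj_ofReal, Complex.conj_I]
    ring
  simp only [hexp]
  split_ifs with hkn
  · simp [hkn, two_mul]
  · have hne : ((n : ℂ) - k) * I ≠ 0 :=
      mul_ne_zero (sub_ne_zero.mpr (by exact_mod_cast Ne.symm hkn)) Complex.I_ne_zero
    rw [integral_exp_mul_complex hne, div_eq_zero_iff, sub_eq_zero,
      Complex.exp_eq_exp_iff_exists_int]
    exact .inl ⟨(n : ℤ) - k, by push_cast; ring⟩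

lemma integral_conj_tsum_mul_tsum {x y : ℕ → ℂ} (hx : Summable x) (hy : Summable y) :
    ∫ θ in -π..π, conj (∑' n, x n * Complex.exp (θ * I) ^ n) * ∑' n, y n * Complex.exp (θ * I) ^ n
      = 2 * π * ∑' n, conj (x n) * y n := by
  have hnorm (z : ℕ → ℂ) (θ : ℝ) (n : ℕ) : ‖z n * Complex.exp (θ * I) ^ n‖ = ‖z n‖ := by
    rw [norm_mul, norm_pow, Complex.norm_exp_ofReal_mul_I, one_pow, mul_one]
  have hbound : Summable fun p : ℕ × ℕ => ‖x p.1‖ * ‖y p.2‖ :=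
    hx.norm.mul_of_nonneg hy.norm (fun _ => norm_nonneg _) (fun _ => norm_nonneg _)
  have hdouble : HasSum (fun p : ℕ × ℕ => ∫ θ in -π..π,
        conj (x p.1 * Complex.exp (θ * I) ^ p.1) * (y p.2 * Complex.exp (θ * I) ^ p.2))
      (∫ θ in -π..π,
        conj (∑' n, x n * Complex.exp (θ * I) ^ n) * ∑' n, y n * Complex.exp (θ * I) ^ n) := by
    refine intervalIntegral.hasSum_integral_of_dominated_convergence
      (fun p _ => ‖x p.1‖ * ‖y p.2‖) (fun p => Continuous.aestronglyMeasurable (by fun_prop))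
      (fun p => .of_forall fun θ _ => ?_) (.of_forall fun _ _ => hbound)
      intervalIntegrable_const (.of_forall fun θ _ => ?_)
    · rw [norm_mul, RCLike.norm_conj, hnorm, hnorm]
    · have hxθ : Summable fun n => ‖conj (x n * Complex.exp (θ * I) ^ n)‖ := by
        simpa only [RCLike.norm_conj, hnorm] using hx.norm
      have hyθ : Summable fun n => ‖y n * Complex.exp (θ * I) ^ n‖ := by
        simpa only [hnorm] using hy.norm
      rw [Complex.conj_tsum, tsum_mul_tsum_of_summable_norm hxθ hyθ]
      exact (summable_mul_of_summable_norm hxθ hyθ).hasSum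
  have horth (p : ℕ × ℕ) : ∫ θ in -π..π,
        conj (x p.1 * Complex.exp (θ * I) ^ p.1) * (y p.2 * Complex.exp (θ * I) ^ p.2)
      = if p.1 = p.2 then 2 * π * (conj (x p.1) * y p.2) else 0 := by
    simp only [map_mul, mul_mul_mul_comm, intervalIntegral.integral_const_mul,
      integral_conj_exp_pow_mul_exp_pow, mul_ite, mul_zero, mul_comm (2 * π : ℂ)]
  have hdiag : Function.Injective fun n : ℕ => (n, n) := fun m n h => congrArg Prod.fst h
  simp only [horth] at hdouble
  rw [← hdouble.tsum_eq, ← tsum_mul_left, ← hdiag.tsum_eq]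
  · simp only [if_true]
  · rintro ⟨k, n⟩ h
    obtain rfl : k = n := by_contra fun hkn => h (if_neg hkn)
    exact ⟨k, rfl⟩

/-! ### Gaussian moments -/

lemma integrable_exp_neg_sq_mul_pow (k : ℕ) :
    Integrable fun x : ℝ => Real.exp (-x ^ 2) * x ^ k := by
  have hk : (-1 : ℝ) < k := by linarith [k.cast_nonneg (α := ℝ)]
  simpa [mul_comm] using integrable_rpow_mul_exp_neg_mul_sq one_pos hk

lemma integral_exp_neg_sq_mul_pow_of_odd {k : ℕ} (hk : Odd k) :
    ∫ x : ℝ, Real.exp (-x ^ 2) * x ^ k = 0 := by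
  have h := integral_neg_eq_self (fun x : ℝ => Real.exp (-x ^ 2) * x ^ k) volume
  simp only [neg_sq, hk.neg_pow, mul_neg, integral_neg] at h
  linarith

lemma integral_exp_neg_sq_mul_pow_two_mul (k : ℕ) :
    ∫ x : ℝ, Real.exp (-x ^ 2) * x ^ (2 * k) = √π * (2 * k - 1 : ℕ)‼ / 2 ^ k := by
  have hk : (-1 : ℝ) < (2 * k : ℕ) := by linarith [(2 * k).cast_nonneg (α := ℝ)]
  have habs := integral_comp_abs (f := fun x : ℝ => Real.exp (-x ^ 2) * x ^ (2 * k))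
  have hGamma := integral_rpow_mul_exp_neg_mul_rpow two_pos hk one_pos
  have hhalf : (((2 * k : ℕ) : ℝ) + 1) / 2 = k + 1 / 2 := by
    push_cast
    ring
  rw [Real.one_rpow, hhalf, Real.Gamma_nat_add_half] at hGamma
  simp only [Real.rpow_natCast, Real.rpow_two, neg_one_mul, mul_comm (_ ^ (2 * k))] at hGamma
  simp only [sq_abs, (even_two_mul k).pow_abs] at habs
  rw [habs, hGamma]
  ring

lemma odd_doubleFactorial_of_odd {n : ℕ} (hn : Odd n) : Odd n‼ := by
  obtain ⟨k, rfl⟩ := hn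
  induction k with
  | zero => simp
  | succ k ih =>
    rw [mul_add_one, add_right_comm, Nat.doubleFactorial_add_two]
    exact Odd.mul ⟨k + 1, by ring⟩ ih

lemma exists_even_two_pow_mul_integral_exp_neg_sq_mul_pow {k M : ℕ} (hk : k < 2 * M) :
    ∃ z : ℤ, Even z ∧ 2 ^ M * ∫ x : ℝ, Real.exp (-x ^ 2) * x ^ k = √π * z := by
  rcases Nat.even_or_odd' k with ⟨j, rfl | rfl⟩
  · have hpow : (2 : ℝ) ^ M = 2 ^ (M - j) * 2 ^ j := by
      rw [← pow_add]
      congr 1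
      lia
    refine ⟨2 ^ (M - j) * (2 * j - 1 : ℕ)‼, (even_two.pow_of_ne_zero (by lia)).mul_right _, ?_⟩
    rw [integral_exp_neg_sq_mul_pow_two_mul, hpow]
    push_cast
    field_simp
  · exact ⟨0, Even.zero, by simp [integral_exp_neg_sq_mul_pow_of_odd ⟨j, rfl⟩]⟩

lemma integral_exp_neg_sq_mul_aeval (P : ℤ[X]) :
    ∫ x : ℝ, Real.exp (-x ^ 2) * aeval x P
      = ∑ k ∈ Finset.range (P.natDegree + 1), P.coeff k * ∫ x : ℝ, Real.exp (-x ^ 2) * x ^ k := by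
  have hsum (x : ℝ) : Real.exp (-x ^ 2) * aeval x P
      = ∑ k ∈ Finset.range (P.natDegree + 1), P.coeff k * (Real.exp (-x ^ 2) * x ^ k) := by
    simp only [aeval_eq_sum_range, Finset.mul_sum, zsmul_eq_mul, mul_left_comm]
  simp only [hsum, ← integral_const_mul]
  exact integral_finsetSum _ fun k _ => (integrable_exp_neg_sq_mul_pow k).const_mul _

-- With `deg P = 2 M`, the integral is `√π / 2 ^ M` times an integer, and this integer is odd, since
-- only the top moment `(2 M - 1)‼` is not even.
lemma integral_exp_neg_sq_mul_aeval_ne_zero {P : ℤ[X]} (hdeg : Even P.natDegree)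
    (hlead : Odd P.leadingCoeff) : ∫ x : ℝ, Real.exp (-x ^ 2) * aeval x P ≠ 0 := by
  obtain ⟨M, hM⟩ := hdeg.exists_two_nsmul
  rw [smul_eq_mul] at hM
  choose! z hz hmoment using
    fun k (hk : k < 2 * M) => exists_even_two_pow_mul_integral_exp_neg_sq_mul_pow hk
  have hint : 2 ^ M * ∫ x : ℝ, Real.exp (-x ^ 2) * aeval x P = √π *
      ((∑ k ∈ Finset.range (2 * M), P.coeff k * z k
        + P.leadingCoeff * (2 * M - 1 : ℕ)‼ : ℤ) : ℝ) := by
    rw [integral_exp_neg_sq_mul_aeval, hM, Finset.sum_range_succ, leadingCoeff, hM,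
      integral_exp_neg_sq_mul_pow_two_mul, mul_add, Finset.mul_sum]
    push_cast
    rw [mul_add, Finset.mul_sum]
    congr 1
    · refine Finset.sum_congr rfl fun k hk => ?_
      rw [mul_left_comm, hmoment k (Finset.mem_range.mp hk), mul_left_comm]
    · field_simp
  have hodd : Odd (∑ k ∈ Finset.range (2 * M), P.coeff k * z k
      + P.leadingCoeff * (2 * M - 1 : ℕ)‼) := by
    refine (Finset.even_sum _ fun k hk => (hz k (Finset.mem_range.mp hk)).mul_left _).add_odd
      (hlead.mul ?_)
    rcases M with _ | M
    · simp
    · exact_mod_cast odd_doubleFactorial_of_odd ⟨M, by lia⟩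
  refine right_ne_zero_of_mul (a := (2 : ℝ) ^ M) (hint ▸ mul_ne_zero (by positivity) ?_)
  exact Int.cast_ne_zero.mpr fun h => Int.not_odd_zero (h ▸ hodd)

/-! ### Laplace's method for angular integrals -/

lemma tendsto_mul_sin_div (x : ℝ) : Tendsto (fun r : ℝ => r * Real.sin (x / r)) atTop (𝓝 x) := by
  have hzero : Tendsto (fun r : ℝ => x / r) atTop (𝓝 0) := tendsto_id.const_div_atTop x
  have hsinc : Tendsto (fun r : ℝ => x * Real.sinc (x / r)) atTop (𝓝 x) := by
    simpa using ((Real.continuous_sinc.tendsto 0).comp hzero).const_mul x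
  refine hsinc.congr' ?_
  filter_upwards [eventually_ne_atTop 0] with r hr
  rcases eq_or_ne x 0 with rfl | hx
  · simp
  · rw [Real.sinc_of_ne_zero (div_ne_zero hx hr)]
    field_simp

lemma tendsto_two_mul_mul_sin_div (x : ℝ) :
    Tendsto (fun r : ℝ => 2 * r * Real.sin (x / r / 2)) atTop (𝓝 x) := by
  have h := (tendsto_mul_sin_div x).comp (tendsto_id.const_mul_atTop (two_pos (α := ℝ)))
  refine h.congr fun r => ?_
  simp only [Function.comp_apply, id_eq, div_div, mul_comm r]

lemma two_div_pi_mul_abs_le_abs_two_mul_mul_sin {r x : ℝ} (hr : 0 < r) (hx : |x| ≤ π * r) :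
    2 / π * |x| ≤ |2 * r * Real.sin (x / r / 2)| := by
  have habs : |x / r / 2| = |x| / r / 2 := by
    rw [abs_div, abs_div, abs_of_pos hr, abs_two]
  have hle : |x / r / 2| ≤ π / 2 := by
    rw [habs]
    gcongr
    rwa [div_le_iff₀ hr]
  calc 2 / π * |x| = 2 * r * (2 / π * |x / r / 2|) := by
        rw [habs]
        field_simp
    _ ≤ 2 * r * |Real.sin (x / r / 2)| := by
        gcongr
        exact Real.mul_abs_le_abs_sin hle
    _ = |2 * r * Real.sin (x / r / 2)| := by
        rw [abs_mul, abs_of_pos (by positivity : 0 < 2 * r)]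

lemma integral_indicator_comp_div {F : ℝ → ℂ} {r : ℝ} (hr : 0 < r) :
    ∫ x, (Set.Ioc (-π * r) (π * r)).indicator (fun x => F (x / r)) x
      = r * ∫ θ in -π..π, F θ := by
  have hle : -π * r ≤ π * r := by nlinarith [Real.pi_pos]
  rw [integral_indicator measurableSet_Ioc, ← intervalIntegral.integral_of_le hle,
    intervalIntegral.integral_comp_div F hr.ne', mul_div_cancel_right₀ _ hr.ne',
    mul_div_cancel_right₀ _ hr.ne', Complex.real_smul]

lemma integrable_exp_neg_mul_sq_mul_one_add_abs {b : ℝ} (hb : 0 < b) :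
    Integrable fun x : ℝ => Real.exp (-b * x ^ 2) * (1 + |x|) := by
  have habs : Integrable fun x : ℝ => Real.exp (-b * x ^ 2) * |x| := by
    simpa [abs_mul, mul_comm] using (integrable_mul_exp_neg_mul_sq hb).abs
  simpa only [mul_add, mul_one] using! (integrable_exp_neg_mul_sq hb).add habs

lemma norm_comp_two_mul_mul_sin_mul_le {f : ℝ → ℂ} {b c C r x : ℝ} {z : ℂ} (hb : 0 ≤ b)
    (hfb : ∀ y, ‖f y‖ ≤ C * Real.exp (-b * y ^ 2)) (hz : ‖z‖ ≤ c * (1 + |x|)) (hr : 0 < r)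
    (hx : |x| ≤ π * r) :
    ‖f (2 * r * Real.sin (x / r / 2)) * z‖
      ≤ C * c * (Real.exp (-(b * (2 / π) ^ 2) * x ^ 2) * (1 + |x|)) := by
  have hC : 0 ≤ C := by simpa using (norm_nonneg _).trans (hfb 0)
  have hsin : (2 / π) ^ 2 * x ^ 2 ≤ (2 * r * Real.sin (x / r / 2)) ^ 2 := by
    rw [← sq_abs x, ← mul_pow, ← sq_abs (2 * r * _)]
    gcongr
    exact two_div_pi_mul_abs_le_abs_two_mul_mul_sin hr hx
  calc ‖f (2 * r * Real.sin (x / r / 2)) * z‖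
      ≤ C * Real.exp (-b * (2 * r * Real.sin (x / r / 2)) ^ 2) * (c * (1 + |x|)) := by
        rw [norm_mul]
        gcongr
        exact hfb _
    _ ≤ C * Real.exp (-(b * (2 / π) ^ 2) * x ^ 2) * (c * (1 + |x|)) := by
        have hexp : -b * (2 * r * Real.sin (x / r / 2)) ^ 2 ≤ -(b * (2 / π) ^ 2) * x ^ 2 := by
          nlinarith
        have hcx := (norm_nonneg z).trans hz
        gcongr ?_ * ?_ * _
        exact Real.exp_le_exp.mpr hexp
    _ = C * c * (Real.exp (-(b * (2 / π) ^ 2) * x ^ 2) * (1 + |x|)) := by ring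

-- Substituting `θ = x / r` moves the integral to `[-π r, π r]`. There `|2 r sin (x / 2r)|`
-- dominates `(2 / π) |x|` and tends to `|x|`.
lemma tendsto_mul_integral_comp_two_mul_mul_sin {f k : ℝ → ℂ} {K : ℝ → ℝ → ℂ} {b c C : ℝ}
    (hf : Continuous f) (hb : 0 < b) (hfb : ∀ y, ‖f y‖ ≤ C * Real.exp (-b * y ^ 2))
    (hK : ∀ r, Continuous (K r)) (hKb : ∀ r θ, ‖K r θ‖ ≤ c * (1 + |r * θ|))
    (hKk : ∀ x, Tendsto (fun r => K r (x / r)) atTop (𝓝 (k x))) :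
    Tendsto (fun r : ℝ => (r : ℂ) * ∫ θ in -π..π, f (2 * r * Real.sin (θ / 2)) * K r θ) atTop
      (𝓝 (∫ x, f x * k x)) := by
  set F : ℝ → ℝ → ℂ := fun r => (Set.Ioc (-π * r) (π * r)).indicator
    fun x => f (2 * r * Real.sin (x / r / 2)) * K r (x / r)
  have hint : Integrable fun x : ℝ =>
      C * c * (Real.exp (-(b * (2 / π) ^ 2) * x ^ 2) * (1 + |x|)) :=
    (integrable_exp_neg_mul_sq_mul_one_add_abs (by positivity)).const_mul _
  have hmeas (r : ℝ) : AEStronglyMeasurable (F r) := by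
    refine Continuous.aestronglyMeasurable ?_ |>.indicator measurableSet_Ioc
    have := hK r
    fun_prop
  have hbound (r : ℝ) (hr : 0 < r) (x : ℝ) :
      ‖F r x‖ ≤ C * c * (Real.exp (-(b * (2 / π) ^ 2) * x ^ 2) * (1 + |x|)) := by
    by_cases hx : x ∈ Set.Ioc (-π * r) (π * r)
    · have hKx := hKb r (x / r)
      rw [mul_div_cancel₀ _ hr.ne'] at hKx
      simp only [F, Set.indicator_of_mem hx]
      exact norm_comp_two_mul_mul_sin_mul_le hb.le hfb hKx hr
        (abs_le.mpr ⟨by linarith [hx.1], hx.2⟩)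
    · have hC : 0 ≤ C := by simpa using (norm_nonneg _).trans (hfb 0)
      have hc : 0 ≤ c := by simpa using (norm_nonneg _).trans (hKb 0 0)
      simp only [F, Set.indicator_of_notMem hx, norm_zero]
      positivity
  have hlim (x : ℝ) : Tendsto (fun r => F r x) atTop (𝓝 (f x * k x)) := by
    refine (((hf.tendsto x).comp (tendsto_two_mul_mul_sin_div x)).mul (hKk x)).congr' ?_
    filter_upwards [eventually_gt_atTop |x|] with r hr
    have hlt : |x| < π * r := by nlinarith [Real.pi_gt_three, abs_nonneg x]
    have hx : x ∈ Set.Ioc (-π * r) (π * r) := by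
      rw [neg_mul]
      exact Set.Ioo_subset_Ioc_self (abs_lt.mp hlt)
    simp only [F, Set.indicator_of_mem hx, Function.comp_apply]
  refine (tendsto_integral_filter_of_dominated_convergence _ (.of_forall hmeas)
    ((eventually_gt_atTop 0).mono fun r hr => .of_forall (hbound r hr)) hint
    (.of_forall hlim)).congr' ?_
  filter_upwards [eventually_gt_atTop 0] with r hr
  exact integral_indicator_comp_div (F := fun θ => f (2 * r * Real.sin (θ / 2)) * K r θ) hr

/-- The integral of a function `f` of the chord length `2 r |sin (θ / 2)|` (with its sign) over the
circle of radius `r`, against a character of half-integer frequency `D / 2`. With a Gaussian weight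
for `f` it gives the entries of the covariance matrix, `r = |β|`. -/
noncomputable def angularIntegral (f : ℝ → ℂ) (D : ℤ) (r : ℝ) : ℂ :=
  ∫ θ in -π..π, f (2 * r * Real.sin (θ / 2)) * Complex.exp ((D * θ / 2 : ℝ) * I)

section Angular

variable {f : ℝ → ℂ} {b C : ℝ} (hf : Continuous f) (hb : 0 < b)
  (hfb : ∀ y, ‖f y‖ ≤ C * Real.exp (-b * y ^ 2))
include hf

lemma angularIntegral_of_odd (hodd : ∀ y, f (-y) = -f y) (D : ℤ) (r : ℝ) :
    angularIntegral f D r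
      = I * ∫ θ in -π..π, f (2 * r * Real.sin (θ / 2)) * Real.sin (D * θ / 2) := by
  set g : ℝ → ℂ := fun θ => f (2 * r * Real.sin (θ / 2)) * Complex.exp ((D * θ / 2 : ℝ) * I) with hg
  have hgc : Continuous g := by fun_prop
  have hreflect : ∫ θ in -π..π, g (-θ) = angularIntegral f D r := by
    rw [intervalIntegral.integral_comp_neg, neg_neg]
    rfl
  have hsym (θ : ℝ) : g θ + g (-θ)
      = 2 * I * (f (2 * r * Real.sin (θ / 2)) * Real.sin (D * θ / 2)) := by
    simp only [hg, neg_div, mul_neg, Real.sin_neg, hodd, Complex.ofReal_neg,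
      Complex.ofReal_sin, Complex.sin]
    linear_combination f (2 * r * Real.sin (θ / 2)) * (Complex.exp ((D * θ / 2 : ℝ) * I)
      - Complex.exp (-(D * θ / 2 : ℝ) * I)) * Complex.I_sq
  have hsum := intervalIntegral.integral_add (μ := volume) (hgc.intervalIntegrable (-π) π)
    ((hgc.comp continuous_neg).intervalIntegrable (-π) π)
  simp only [Function.comp_apply, hsym, hreflect, intervalIntegral.integral_const_mul] at hsum
  have hdef : ∫ θ in -π..π, g θ = angularIntegral f D r := rfl
  rw [hdef] at hsum
  linear_combination -hsum / 2

include hb hfb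

lemma tendsto_mul_angularIntegral (D : ℤ) :
    Tendsto (fun r : ℝ => (r : ℂ) * angularIntegral f D r) atTop (𝓝 (∫ x, f x)) := by
  have h := tendsto_mul_integral_comp_two_mul_mul_sin (k := fun _ => 1) (c := 1)
    (K := fun _ θ => Complex.exp ((D * θ / 2 : ℝ) * I)) hf hb hfb
    (fun _ => by fun_prop) (fun _ θ => ?_) fun x => ?_
  · simpa only [angularIntegral, mul_one] using h
  · rw [Complex.norm_exp_ofReal_mul_I, one_mul]
    exact le_add_of_nonneg_right (abs_nonneg _)
  · have hphase : Continuous fun θ : ℝ => Complex.exp ((D * θ / 2 : ℝ) * I) := by fun_prop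
    exact (hphase.tendsto' 0 1 (by simp)).comp (tendsto_id.const_div_atTop x)

lemma tendsto_sq_mul_angularIntegral_of_odd (hodd : ∀ y, f (-y) = -f y) (D : ℤ) :
    Tendsto (fun r : ℝ => (r : ℂ) ^ 2 * angularIntegral f D r) atTop
      (𝓝 (I * (D / 2) * ∫ x : ℝ, x * f x)) := by
  have h := tendsto_mul_integral_comp_two_mul_mul_sin (k := fun x => ((D * x / 2 : ℝ) : ℂ))
    (c := |(D / 2 : ℝ)|) (K := fun r θ => ((r * Real.sin (D * θ / 2) : ℝ) : ℂ)) hf hb hfb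
    (fun r => by fun_prop) (fun r θ => ?_) fun x => ?_
  · have hlim : I * ∫ x : ℝ, f x * ((D * x / 2 : ℝ) : ℂ) = I * (D / 2) * ∫ x : ℝ, x * f x := by
      rw [mul_assoc, ← integral_const_mul (D / 2 : ℂ)]
      refine congrArg (I * ·) (integral_congr_ae (.of_forall fun x => ?_))
      dsimp only
      push_cast
      ring
    rw [← hlim]
    refine (h.const_mul I).congr fun r => ?_
    simp only [angularIntegral_of_odd hf hodd, Complex.ofReal_mul, mul_left_comm (f _) (r : ℂ),
      intervalIntegral.integral_const_mul]
    ring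
  · rw [Complex.norm_real, Real.norm_eq_abs]
    calc |r * Real.sin (D * θ / 2)| ≤ |r| * |D * θ / 2| := by
          rw [abs_mul]
          exact mul_le_mul_of_nonneg_left Real.abs_sin_le_abs (abs_nonneg r)
      _ = |(D / 2 : ℝ)| * |r * θ| := by
          rw [← abs_mul, ← abs_mul]
          congr 1
          ring
      _ ≤ |(D / 2 : ℝ)| * (1 + |r * θ|) := by
          gcongr
          exact le_add_of_nonneg_left zero_le_one
  · refine (Complex.continuous_ofReal.tendsto _).comp
      ((tendsto_mul_sin_div (D * x / 2)).congr fun r => ?_)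
    congr 2
    ring

end Angular

/-! ### Entries of the covariance matrix -/

lemma conj_exp_ofReal_mul_I (x : ℝ) : conj (Complex.exp (x * I)) = Complex.exp (-x * I) := by
  rw [← Complex.exp_conj, map_mul, Complex.conj_ofReal, Complex.conj_I, mul_neg, neg_mul]

lemma exp_mul_I_sub_one (θ : ℝ) :
    Complex.exp (θ * I) - 1 = 2 * I * Real.sin (θ / 2) * Complex.exp ((θ / 2 : ℝ) * I) := by
  have hsq : Complex.exp (θ * I) = Complex.exp ((θ / 2 : ℝ) * I) ^ 2 := by
    rw [← Complex.exp_nat_mul]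
    congr 1
    push_cast
    ring
  have hinv : Complex.exp (-(θ / 2 : ℝ) * I) * Complex.exp ((θ / 2 : ℝ) * I) = 1 := by
    rw [← Complex.exp_add, ← add_mul, neg_add_cancel, zero_mul, Complex.exp_zero]
  rw [hsq, Complex.ofReal_sin, Complex.sin]
  linear_combination Complex.exp ((θ / 2 : ℝ) * I) * (Complex.exp ((θ / 2 : ℝ) * I)
    - Complex.exp (-(θ / 2 : ℝ) * I)) * Complex.I_sq + hinv

lemma conj_exp_mul_exp_sq_mul_exp_mul_I_sub_one (r θ : ℝ) :
    conj (Complex.exp ((r : ℂ) ^ 2 * (Complex.exp (θ * I) - 1)))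
        * Complex.exp ((r : ℂ) ^ 2 * (Complex.exp (θ * I) - 1))
      = Real.exp (-(2 * r * Real.sin (θ / 2)) ^ 2) := by
  have hcos : Real.cos θ = 1 - 2 * Real.sin (θ / 2) ^ 2 := by
    rw [← Real.cos_two_mul_eq_one_sub, mul_div_cancel₀ _ two_ne_zero]
  have hre : ((r : ℂ) ^ 2 * (Complex.exp (θ * I) - 1)).re = -2 * (r * Real.sin (θ / 2)) ^ 2 := by
    rw [← Complex.ofReal_pow, Complex.re_ofReal_mul, Complex.sub_re, Complex.exp_ofReal_mul_I_re,
      Complex.one_re, hcos]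
    ring
  rw [Complex.conj_mul', Complex.norm_exp, hre, ← Complex.ofReal_pow, ← Real.exp_nat_mul]
  congr 2
  push_cast
  ring

lemma overlapSeries_neg_exp_mul_I (β : ℂ) (θ : ℝ) (a b : ℕ) :
    overlapSeries (-β) (Complex.exp (θ * I)) a b
      = Complex.exp ((‖β‖ : ℂ) ^ 2 * (Complex.exp (θ * I) - 1))
        * (-I * Complex.exp ((θ / 2 - β.arg : ℝ) * I)) ^ a
        * (-I * Complex.exp ((θ / 2 + β.arg : ℝ) * I)) ^ b
        * (aeval (2 * ‖β‖ * Real.sin (θ / 2)) (itoHermite a b) : ℝ) := by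
  have hβ : β = ‖β‖ * Complex.exp (β.arg * I) := (Complex.norm_mul_exp_arg_mul_I β).symm
  have hβ' : conj β = ‖β‖ * Complex.exp (-β.arg * I) := by
    conv_lhs => rw [hβ]
    rw [map_mul, Complex.conj_ofReal, conj_exp_ofReal_mul_I]
  have h := overlapSeries_eq_exp_mul_aeval_itoHermite (-β) (Complex.norm_exp_ofReal_mul_I θ)
    (η := -I * Complex.exp ((θ / 2 - β.arg : ℝ) * I))
    (η' := -I * Complex.exp ((θ / 2 + β.arg : ℝ) * I))
    (y := ((2 * ‖β‖ * Real.sin (θ / 2) : ℝ) : ℂ)) ?_ ?_ ?_ a b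
  · rwa [norm_neg, ← Complex.coe_algebraMap, aeval_algebraMap_apply] at h
  · rw [exp_mul_I_sub_one, map_neg, hβ', Complex.ofReal_sub, sub_eq_add_neg, add_mul,
      Complex.exp_add]
    push_cast
    ring
  · rw [exp_mul_I_sub_one, Complex.ofReal_add, add_mul, Complex.exp_add]
    nth_rw 1 [hβ]
    push_cast
    ring
  · have hexp : Complex.exp (θ * I) = Complex.exp ((θ / 2 - β.arg : ℝ) * I)
        * Complex.exp ((θ / 2 + β.arg : ℝ) * I) := by
      rw [← Complex.exp_add]
      congr 1
      push_cast
      ring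
    rw [hexp]
    linear_combination Complex.exp ((θ / 2 - β.arg : ℝ) * I)
      * Complex.exp ((θ / 2 + β.arg : ℝ) * I) * Complex.I_sq

/-- The function `exp (-y ^ 2) P(y)`, complex-valued so that it can serve as the weight of an
angular integral. -/
noncomputable def gaussianWeight (P : ℤ[X]) (y : ℝ) : ℂ :=
  (Real.exp (-y ^ 2) * aeval y P : ℝ)

/-- The polynomial of the entry `(m₁, m₂), (m₃, m₄)` of the covariance matrix. -/
noncomputable def covariancePoly (m₁ m₂ m₃ m₄ : ℕ) : ℤ[X] :=
  itoHermite m₁ m₂ * itoHermite m₃ m₄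

/-- The phase and normalisation of the entry `(m₁, m₂), (m₃, m₄)` of the covariance matrix at
displacements of argument `t`. -/
noncomputable def covariancePrefactor (m₁ m₂ m₃ m₄ : ℕ) (t : ℝ) : ℂ :=
  I ^ (m₁ + m₂) * (-I) ^ (m₃ + m₄) * Complex.exp ((t * (m₁ - m₂ - m₃ + m₄) : ℝ) * I)
    / (2 * π * (√(m₁ !) * √(m₂ !) * √(m₃ !) * √(m₄ !)))

lemma covariancePrefactor_ne_zero (m₁ m₂ m₃ m₄ : ℕ) (t : ℝ) :
    covariancePrefactor m₁ m₂ m₃ m₄ t ≠ 0 := by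
  simp [covariancePrefactor, Complex.exp_ne_zero, Nat.factorial_ne_zero]

lemma isMonicOfDegree_covariancePoly (m₁ m₂ m₃ m₄ : ℕ) :
    (covariancePoly m₁ m₂ m₃ m₄).IsMonicOfDegree (m₁ + m₂ + m₃ + m₄) := by
  rw [add_assoc (m₁ + m₂)]
  exact (isMonicOfDegree_itoHermite m₁ m₂).mul (isMonicOfDegree_itoHermite m₃ m₄)

lemma aeval_neg_covariancePoly {m₁ m₂ m₃ m₄ : ℕ} (h : Odd (m₁ + m₂ + m₃ + m₄)) (y : ℝ) :
    aeval (-y) (covariancePoly m₁ m₂ m₃ m₄) = -aeval y (covariancePoly m₁ m₂ m₃ m₄) := by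
  rw [covariancePoly, map_mul, map_mul, aeval_neg_itoHermite, aeval_neg_itoHermite,
    mul_mul_mul_comm, ← pow_add, ← add_assoc, h.neg_one_pow, neg_one_mul]

lemma conj_overlapSeries_mul_overlapSeries (β : ℂ) (θ : ℝ) (m₁ m₂ m₃ m₄ : ℕ) :
    conj (overlapSeries (-β) (Complex.exp (θ * I)) m₁ m₂)
        * overlapSeries (-β) (Complex.exp (θ * I)) m₃ m₄
      = I ^ (m₁ + m₂) * (-I) ^ (m₃ + m₄) * Complex.exp ((β.arg * (m₁ - m₂ - m₃ + m₄) : ℝ) * I)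
        * (gaussianWeight (covariancePoly m₁ m₂ m₃ m₄) (2 * ‖β‖ * Real.sin (θ / 2))
          * Complex.exp (((m₃ + m₄ - m₁ - m₂ : ℤ) * θ / 2 : ℝ) * I)) := by
  have hphase : Complex.exp (-(θ / 2 - β.arg : ℝ) * I) ^ m₁
        * Complex.exp (-(θ / 2 + β.arg : ℝ) * I) ^ m₂
        * (Complex.exp ((θ / 2 - β.arg : ℝ) * I) ^ m₃ * Complex.exp ((θ / 2 + β.arg : ℝ) * I) ^ m₄)
      = Complex.exp ((β.arg * (m₁ - m₂ - m₃ + m₄) : ℝ) * I)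
        * Complex.exp (((m₃ + m₄ - m₁ - m₂ : ℤ) * θ / 2 : ℝ) * I) := by
    simp only [← Complex.exp_nat_mul, ← Complex.exp_add]
    congr 1
    push_cast
    ring
  rw [overlapSeries_neg_exp_mul_I, overlapSeries_neg_exp_mul_I, gaussianWeight, covariancePoly,
    map_mul (aeval _), Complex.ofReal_mul (Real.exp _), Complex.ofReal_mul (aeval _ _),
    ← conj_exp_mul_exp_sq_mul_exp_mul_I_sub_one]
  simp only [map_mul, map_pow, map_neg, conj_exp_ofReal_mul_I, Complex.conj_I, Complex.conj_ofReal,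
    neg_neg]
  linear_combination conj (Complex.exp ((‖β‖ : ℂ) ^ 2 * (Complex.exp (θ * I) - 1)))
    * Complex.exp ((‖β‖ : ℂ) ^ 2 * (Complex.exp (θ * I) - 1)) * I ^ (m₁ + m₂) * (-I) ^ (m₃ + m₄)
    * (aeval (2 * ‖β‖ * Real.sin (θ / 2)) (itoHermite m₁ m₂) : ℝ)
    * (aeval (2 * ‖β‖ * Real.sin (θ / 2)) (itoHermite m₃ m₄) : ℝ) * hphase

lemma covarianceMatrix_eq_integral_overlapSeries (β : ℂ) (m₁ m₂ m₃ m₄ : ℕ) :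
    2 * π * (√(m₁ !) * √(m₂ !) * √(m₃ !) * √(m₄ !)) * covarianceMatrix β (m₁, m₂) (m₃, m₄)
      = ∫ θ in -π..π, conj (overlapSeries (-β) (Complex.exp (θ * I)) m₁ m₂)
          * overlapSeries (-β) (Complex.exp (θ * I)) m₃ m₄ := by
  simp only [overlapSeries]
  rw [integral_conj_tsum_mul_tsum (summable_displacedCoeff_mul_conj _ _ _)
    (summable_displacedCoeff_mul_conj _ _ _), covarianceMatrix, mul_assoc, ← tsum_mul_left]
  congr 1
  refine tsum_congr fun n => ?_
  rw [← sqrt_factorial_mul_sensingMatrix, ← sqrt_factorial_mul_sensingMatrix]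
  simp only [map_mul, Complex.conj_ofReal]
  ring

lemma covarianceMatrix_eq_prefactor_mul_angularIntegral (β : ℂ) (m₁ m₂ m₃ m₄ : ℕ) :
    covarianceMatrix β (m₁, m₂) (m₃, m₄) = covariancePrefactor m₁ m₂ m₃ m₄ β.arg
      * angularIntegral (gaussianWeight (covariancePoly m₁ m₂ m₃ m₄)) (m₃ + m₄ - m₁ - m₂) ‖β‖ := by
  have hnorm : (2 * π * (√(m₁ !) * √(m₂ !) * √(m₃ !) * √(m₄ !)) : ℂ) ≠ 0 := by
    simp [Nat.factorial_ne_zero]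
  have h := covarianceMatrix_eq_integral_overlapSeries β m₁ m₂ m₃ m₄
  simp only [conj_overlapSeries_mul_overlapSeries, intervalIntegral.integral_const_mul] at h
  rw [covariancePrefactor, div_mul_eq_mul_div, eq_div_iff hnorm, mul_comm, h, angularIntegral]

/-! ### Asymptotics -/

lemma continuous_gaussianWeight (P : ℤ[X]) : Continuous (gaussianWeight P) := by
  have := P.continuous_aeval (A := ℝ)
  unfold gaussianWeight
  fun_prop

lemma abs_pow_le_factorial_mul_exp (n : ℕ) (y : ℝ) :
    |y ^ n| ≤ n ! * Real.exp (1 / 2) * Real.exp (y ^ 2 / 2) := by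
  have hfac : (0 : ℝ) < n ! := by positivity
  calc |y ^ n| ≤ n ! * Real.exp |y| := by
        rw [abs_pow, ← div_le_iff₀' hfac]
        exact Real.pow_div_factorial_le_exp _ (abs_nonneg y) n
    _ ≤ n ! * Real.exp (1 / 2 + y ^ 2 / 2) := by
        gcongr
        nlinarith [sq_nonneg (|y| - 1), sq_abs y]
    _ = n ! * Real.exp (1 / 2) * Real.exp (y ^ 2 / 2) := by rw [Real.exp_add, mul_assoc]

lemma exists_abs_aeval_le_mul_exp (P : ℤ[X]) :
    ∃ C, ∀ y : ℝ, |aeval y P| ≤ C * Real.exp (y ^ 2 / 2) := by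
  induction P using Polynomial.induction_on' with
  | add P Q hP hQ =>
    obtain ⟨C, hC⟩ := hP
    obtain ⟨C', hC'⟩ := hQ
    refine ⟨C + C', fun y => ?_⟩
    rw [map_add, add_mul]
    exact (abs_add_le _ _).trans (add_le_add (hC y) (hC' y))
  | monomial n z =>
    refine ⟨|(z : ℝ)| * (n ! * Real.exp (1 / 2)), fun y => ?_⟩
    rw [aeval_monomial, abs_mul, mul_assoc |(z : ℝ)|]
    exact mul_le_mul_of_nonneg_left (abs_pow_le_factorial_mul_exp n y) (abs_nonneg _)

lemma exists_norm_gaussianWeight_le (P : ℤ[X]) :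
    ∃ C, ∀ y, ‖gaussianWeight P y‖ ≤ C * Real.exp (-(1 / 2) * y ^ 2) := by
  obtain ⟨C, hC⟩ := exists_abs_aeval_le_mul_exp P
  refine ⟨C, fun y => ?_⟩
  calc ‖gaussianWeight P y‖ = Real.exp (-y ^ 2) * |aeval y P| := by
        rw [gaussianWeight, Complex.norm_real, norm_mul, Real.norm_eq_abs, Real.abs_exp,
          Real.norm_eq_abs]
    _ ≤ Real.exp (-y ^ 2) * (C * Real.exp (y ^ 2 / 2)) := by
        gcongr
        exact hC y
    _ = C * Real.exp (-(1 / 2) * y ^ 2) := by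
        rw [mul_left_comm, ← Real.exp_add]
        congr 2
        ring

lemma integral_gaussianWeight_ne_zero {P : ℤ[X]} {s : ℕ} (hP : P.IsMonicOfDegree s)
    (hs : Even s) : ∫ x, gaussianWeight P x ≠ 0 := by
  unfold gaussianWeight
  rw [integral_complex_ofReal]
  refine Complex.ofReal_ne_zero.mpr (integral_exp_neg_sq_mul_aeval_ne_zero ?_ ?_)
  · rwa [hP.natDegree_eq]
  · rw [hP.leadingCoeff_eq]
    exact odd_one

lemma exists_tendsto_mul_angularIntegral_gaussianWeight {P : ℤ[X]} {s : ℕ}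
    (hP : P.IsMonicOfDegree s) (hs : Even s) (D : ℤ) :
    ∃ J ≠ 0, Tendsto (fun r : ℝ => (r : ℂ) * angularIntegral (gaussianWeight P) D r) atTop
      (𝓝 J) := by
  obtain ⟨C, hC⟩ := exists_norm_gaussianWeight_le P
  exact ⟨_, integral_gaussianWeight_ne_zero hP hs,
    tendsto_mul_angularIntegral (continuous_gaussianWeight P) one_half_pos hC D⟩

lemma exists_tendsto_sq_mul_angularIntegral_gaussianWeight {P : ℤ[X]} {s : ℕ}
    (hP : P.IsMonicOfDegree s) (hs : Odd s) (hodd : ∀ y : ℝ, aeval (-y) P = -aeval y P) {D : ℤ}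
    (hD : D ≠ 0) :
    ∃ J ≠ 0, Tendsto (fun r : ℝ => (r : ℂ) ^ 2 * angularIntegral (gaussianWeight P) D r) atTop
      (𝓝 J) := by
  obtain ⟨C, hC⟩ := exists_norm_gaussianWeight_le P
  refine ⟨_, mul_ne_zero (by simp [hD]) ?_, tendsto_sq_mul_angularIntegral_of_odd
    (continuous_gaussianWeight P) one_half_pos hC (fun y => ?_) D⟩
  · have hX (x : ℝ) : x * gaussianWeight P x = gaussianWeight (X * P) x := by
      simp only [gaussianWeight, map_mul, aeval_X]
      push_cast
      ring
    simp only [hX]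
    exact integral_gaussianWeight_ne_zero ((isMonicOfDegree_X ℤ).mul hP) (odd_one.add_odd hs)
  · simp only [gaussianWeight, neg_sq, hodd, mul_neg, Complex.ofReal_neg]

lemma isEquivalent_of_tendsto_pow_mul {u : ℂ → ℂ} {κ v : ℝ → ℂ} {J : ℂ} {p : ℕ}
    (hu : ∀ β, u β = κ β.arg * v ‖β‖) (hκ : ∀ t, κ t ≠ 0) (hJ : J ≠ 0)
    (hv : Tendsto (fun r : ℝ => (r : ℂ) ^ p * v r) atTop (𝓝 J)) :
    u ~[Bornology.cobounded ℂ] fun β => κ β.arg * J / (‖β‖ : ℂ) ^ p := by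
  have hne : ∀ᶠ β : ℂ in Bornology.cobounded ℂ, (‖β‖ : ℂ) ≠ 0 :=
    (tendsto_norm_cobounded_atTop.eventually_gt_atTop 0).mono fun β hβ =>
      Complex.ofReal_ne_zero.mpr hβ.ne'
  rw [Asymptotics.isEquivalent_iff_tendsto_one (hne.mono fun β hβ =>
    div_ne_zero (mul_ne_zero (hκ _) hJ) (pow_ne_zero _ hβ))]
  have h := (hv.comp (tendsto_norm_cobounded_atTop (E := ℂ))).div_const J
  rw [div_self hJ] at h
  refine h.congr' (hne.mono fun β hβ => ?_)
  have := hκ β.arg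
  simp only [Function.comp_apply, Pi.div_apply, hu]
  field_simp

lemma exists_covarianceMatrix_isEquivalent_of_even {m₁ m₂ m₃ m₄ : ℕ}
    (h : Even (m₁ + m₂ + m₃ + m₄)) :
    ∃ J ≠ 0, (fun β => covarianceMatrix β (m₁, m₂) (m₃, m₄)) ~[Bornology.cobounded ℂ]
      fun β => covariancePrefactor m₁ m₂ m₃ m₄ β.arg * J / ‖β‖ := by
  obtain ⟨J, hJ, hlim⟩ := exists_tendsto_mul_angularIntegral_gaussianWeight
    (isMonicOfDegree_covariancePoly m₁ m₂ m₃ m₄) h (m₃ + m₄ - m₁ - m₂)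
  have hequiv := isEquivalent_of_tendsto_pow_mul (p := 1)
    (fun β => covarianceMatrix_eq_prefactor_mul_angularIntegral β m₁ m₂ m₃ m₄)
    (covariancePrefactor_ne_zero m₁ m₂ m₃ m₄) hJ (by simpa only [pow_one] using hlim)
  simp only [pow_one] at hequiv
  exact ⟨J, hJ, hequiv⟩

lemma exists_covarianceMatrix_isEquivalent_of_odd {m₁ m₂ m₃ m₄ : ℕ}
    (h : Odd (m₁ + m₂ + m₃ + m₄)) :
    ∃ J ≠ 0, (fun β => covarianceMatrix β (m₁, m₂) (m₃, m₄)) ~[Bornology.cobounded ℂ]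
      fun β => covariancePrefactor m₁ m₂ m₃ m₄ β.arg * J / (‖β‖ : ℂ) ^ 2 := by
  have hD : (m₃ + m₄ - m₁ - m₂ : ℤ) ≠ 0 := by
    obtain ⟨k, hk⟩ := h
    lia
  obtain ⟨J, hJ, hlim⟩ := exists_tendsto_sq_mul_angularIntegral_gaussianWeight
    (isMonicOfDegree_covariancePoly m₁ m₂ m₃ m₄) h (aeval_neg_covariancePoly h) hD
  exact ⟨J, hJ, isEquivalent_of_tendsto_pow_mul
    (fun β => covarianceMatrix_eq_prefactor_mul_angularIntegral β m₁ m₂ m₃ m₄)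
    (covariancePrefactor_ne_zero m₁ m₂ m₃ m₄) hJ hlim⟩

lemma exists_covarianceMatrix_isEquivalent (m₁ m₂ m₃ m₄ : ℕ) :
    ∃ J ≠ 0,
      (Even (m₁ + m₂ + m₃ + m₄) →
        (fun β => covarianceMatrix β (m₁, m₂) (m₃, m₄)) ~[Bornology.cobounded ℂ]
          fun β => covariancePrefactor m₁ m₂ m₃ m₄ β.arg * J / ‖β‖) ∧
      (Odd (m₁ + m₂ + m₃ + m₄) →
        (fun β => covarianceMatrix β (m₁, m₂) (m₃, m₄)) ~[Bornology.cobounded ℂ]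
          fun β => covariancePrefactor m₁ m₂ m₃ m₄ β.arg * J / (‖β‖ : ℂ) ^ 2) := by
  rcases Nat.even_or_odd (m₁ + m₂ + m₃ + m₄) with heven | hodd
  · obtain ⟨J, hJ, hequiv⟩ := exists_covarianceMatrix_isEquivalent_of_even heven
    exact ⟨J, hJ, fun _ => hequiv, fun hodd => absurd heven (Nat.not_even_iff_odd.mpr hodd)⟩
  · obtain ⟨J, hJ, hequiv⟩ := exists_covarianceMatrix_isEquivalent_of_odd hodd
    exact ⟨J, hJ, fun heven => absurd heven (Nat.not_even_iff_odd.mpr hodd), fun _ => hequiv⟩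

end FockTomography

theorem theorem1 :
    ∃ g : ℕ → ℕ → ℕ → ℕ → ℝ → ℂ,
      ∀ m₁ m₂ m₃ m₄ : ℕ,
        (∀ φ : ℝ, g m₁ m₂ m₃ m₄ φ ≠ 0) ∧
        (Even (m₁ + m₂ + m₃ + m₄) →
          (fun β : ℂ => FockTomography.covarianceMatrix β (m₁, m₂) (m₃, m₄))
            ~[Bornology.cobounded ℂ]
          (fun β : ℂ => g m₁ m₂ m₃ m₄ (Complex.arg β) / (‖β‖ : ℂ))) ∧
        (Odd (m₁ + m₂ + m₃ + m₄) →
          (fun β : ℂ => FockTomography.covarianceMatrix β (m₁, m₂) (m₃, m₄))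
            ~[Bornology.cobounded ℂ]
          (fun β : ℂ => g m₁ m₂ m₃ m₄ (Complex.arg β) / (‖β‖ : ℂ) ^ 2)) := by
  choose J hJ heven hodd using FockTomography.exists_covarianceMatrix_isEquivalent
  exact ⟨fun m₁ m₂ m₃ m₄ φ => FockTomography.covariancePrefactor m₁ m₂ m₃ m₄ φ * J m₁ m₂ m₃ m₄,
    fun m₁ m₂ m₃ m₄ => ⟨fun φ => mul_ne_zero
      (FockTomography.covariancePrefactor_ne_zero m₁ m₂ m₃ m₄ φ) (hJ m₁ m₂ m₃ m₄),
      heven m₁ m₂ m₃ m₄, hodd m₁ m₂ m₃ m₄⟩⟩
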